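/- Let $\mathcal D$ be the space of smooth compactly supported functions $\mathbb R\to\mathbb C$ and $\mathcal D'$ the space of distributions on $\mathbb R$. Let $\mathcal D_{L^1}$ be the space of smooth functions $\varphi:\mathbb R\to\mathbb C$ all of whose derivatives $\varphi^{(i)}$, $i\ge 0$, belong to $L^1(\mathbb R)$, with the topology defined by the norms $|\varphi|_{m,1}=\sum_{i=0}^m\|\varphi^{(i)}\|_{L^1}$, $m\ge 0$, and let $\mathcal D'_{L^\infty}\subset\mathcal D'$ be its topological dual (bounded distributions). A continuous function $f:\mathbb R\to\mathbb C$ is called almost automorphic if every real sequence $(s_m)$ has a subsequence $(s_{m_k})$ such that, for some function $g$, $\lim_k f(x+s_{m_k})=g(x)$ and $\lim_k g(x-s_{m_k})=f(x)$ for every $x\in\mathbb R$. A distribution $T\in\mathcal D'_{L^\infty}$ is called almost automorphic if, for every $\varphi\in\mathcal D$, the function $T*\varphi$, $(T*\varphi)(x)=\langle T,\varphi(x-\cdot)\rangle$, is almost automorphic; a vector of distributions is almost automorphic if all its components are. Theorem. Let $A$ be a $p\times p$ matrix of complex numbers with no eigenvalue of real part zero, and let $S=(S_1,\dots,S_p)$,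 where every $S_i$ is an almost automorphic distribution. Then the system $U'=AU+S$ (in the sense of distributions) has a unique solution $U\in(\mathcal D'_{L^\infty})^p$, and this solution is an almost automorphic vector distribution. -/

import Mathlib

open Filter Topology MeasureTheory TopologicalSpace
open scoped ContDiff

/-- A continuous function `f : ℝ → ℂ` is almost automorphic (in the sense of Bochner) if every real
sequence `s` has a subsequence along which `f (x + s (k n))` converges for every `x` to some `g x`,
and `g (x - s (k n))` converges to `f x` for every `x`. -/
def IsAlmostAutomorphicFun (f : ℝ → ℂ) : Prop :=
  Continuous f ∧ ∀ s : ℕ → ℝ, ∃ k : ℕ → ℕ, StrictMono k ∧ ∃ g : ℝ → ℂ,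
    (∀ x, Tendsto (fun n => f (x + s (k n))) atTop (𝓝 (g x))) ∧
    (∀ x, Tendsto (fun n => g (x - s (k n))) atTop (𝓝 (f x)))

/-- The space of smooth compactly supported functions `ℝ → ℂ`, with its usual
(locally convex inductive limit) topology. -/
abbrev TestFun : Type := TestFunction (⊤ : Opens ℝ) ℂ (⊤ : ℕ∞)

/-- Complex distributions on `ℝ`: the topological dual of the space of test functions. -/
abbrev CDistrib : Type := TestFun →L[ℂ] ℂ

namespace CDistrib

/-- The derivative of a distribution: `⟨T', φ⟩ = -⟨T, φ'⟩`. -/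
noncomputable def derivative (T : CDistrib) : CDistrib :=
  -(T.comp (TestFunction.lineDerivCLM ℂ (1 : ℝ) : TestFun →L[ℂ] TestFun))

/-- `lineDerivCLM` in the direction `1` is the ordinary derivative of a test function. -/
theorem lineDeriv_one_apply (φ : TestFun) (x : ℝ) :
    (TestFunction.lineDerivCLM ℂ (1 : ℝ) φ : TestFun) x = deriv φ x := by
  rw [TestFunction.lineDerivCLM_apply_of_le (by simp)]
  simp [lineDeriv, deriv_comp_const_add]

theorem derivative_apply (T : CDistrib) (φ : TestFun) :
    T.derivative φ = -T (TestFunction.lineDerivCLM ℂ (1 : ℝ) φ : TestFun) := rfl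

/-- The test function `y ↦ φ (x - y)`. -/
noncomputable def reflect (φ : TestFun) (x : ℝ) : TestFun where
  toFun y := φ (x - y)
  contDiff' := φ.contDiff.comp (contDiff_const.sub contDiff_id)
  hasCompactSupport' := φ.hasCompactSupport.comp_homeomorph (Homeomorph.subLeft x)
  tsupport_subset' := by simp

/-- The convolution of a distribution with a test function: `(T * φ)(x) = ⟨T, φ(x - ·)⟩`. -/
noncomputable def conv (T : CDistrib) (φ : TestFun) (x : ℝ) : ℂ := T (reflect φ x)

end CDistrib

/-- Smooth functions `ℝ → ℂ` all of whose derivatives (of order `0, 1, 2, …`) are in `L¹`. -/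
def smoothL1Submodule : Submodule ℂ (ℝ → ℂ) where
  carrier := {φ | ContDiff ℝ ∞ φ ∧ ∀ i : ℕ, Integrable (iteratedDeriv i φ)}
  zero_mem' := ⟨contDiff_const, fun i => by
    have : iteratedDeriv i (0 : ℝ → ℂ) = 0 := by
      ext x
      exact iteratedDeriv_const_zero
    rw [this]
    exact integrable_zero _ _ _⟩
  add_mem' := by
    rintro φ ψ ⟨h₁, h₂⟩ ⟨h₃, h₄⟩
    refine ⟨h₁.add h₃, fun i => ?_⟩
    have : iteratedDeriv i (φ + ψ) = iteratedDeriv i φ + iteratedDeriv i ψ := by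
      ext x
      exact iteratedDeriv_add ((h₁.of_le (mod_cast le_top)).contDiffAt)
        ((h₃.of_le (mod_cast le_top)).contDiffAt)
    rw [this]
    exact (h₂ i).add (h₄ i)
  smul_mem' := by
    rintro c φ ⟨h₁, h₂⟩
    refine ⟨contDiff_const.smul h₁, fun i => ?_⟩
    have : iteratedDeriv i (c • φ) = c • iteratedDeriv i φ := by
      ext x
      exact iteratedDeriv_const_smul ((h₁.of_le (mod_cast le_top)).contDiffAt) c
    rw [this]
    exact (h₂ i).smul c

/-- The space `𝓓_{L¹}`. It is a type of its own, so that its topology (below) is the one given by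
the norms `∑_{i ≤ m} ‖φ⁽ⁱ⁾‖_{L¹}` and not that of pointwise convergence. -/
def SmoothL1 : Type := smoothL1Submodule

namespace SmoothL1

noncomputable instance : AddCommGroup SmoothL1 := inferInstanceAs (AddCommGroup smoothL1Submodule)

noncomputable instance : Module ℂ SmoothL1 := inferInstanceAs (Module ℂ smoothL1Submodule)

/-- The underlying function of an element of `𝓓_{L¹}`. -/
def toFun (φ : SmoothL1) : ℝ → ℂ := φ.1

instance : CoeFun SmoothL1 (fun _ => ℝ → ℂ) := ⟨toFun⟩

theorem contDiff (φ : SmoothL1) : ContDiff ℝ ∞ φ := φ.2.1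

theorem integrable (φ : SmoothL1) (i : ℕ) : Integrable (iteratedDeriv i φ) := φ.2.2 i

theorem iteratedDeriv_add_apply (φ ψ : SmoothL1) (i : ℕ) (x : ℝ) :
    iteratedDeriv i (φ + ψ : SmoothL1) x = iteratedDeriv i φ x + iteratedDeriv i ψ x :=
  iteratedDeriv_add ((φ.contDiff.of_le (mod_cast le_top)).contDiffAt)
    ((ψ.contDiff.of_le (mod_cast le_top)).contDiffAt)

theorem iteratedDeriv_smul_apply (c : ℂ) (φ : SmoothL1) (i : ℕ) (x : ℝ) :
    iteratedDeriv i (c • φ : SmoothL1) x = c * iteratedDeriv i φ x :=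
  iteratedDeriv_const_smul ((φ.contDiff.of_le (mod_cast le_top)).contDiffAt) c

/-- The norms `|φ|_{m,1} = ∑_{i ≤ m} ‖φ⁽ⁱ⁾‖_{L¹}`. -/
noncomputable def norms : SeminormFamily ℂ SmoothL1 ℕ := fun m =>
  Seminorm.of (fun φ => ∑ i ∈ Finset.range (m + 1), ∫ x, ‖iteratedDeriv i φ x‖)
    (fun φ ψ => by
      rw [← Finset.sum_add_distrib]
      refine Finset.sum_le_sum fun i _ => ?_
      rw [← integral_add (φ.integrable i).norm (ψ.integrable i).norm]
      refine integral_mono ((φ + ψ).integrable i).norm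
        ((φ.integrable i).norm.add (ψ.integrable i).norm) fun x => ?_
      simp only [iteratedDeriv_add_apply]
      exact norm_add_le _ _)
    (fun c φ => by
      simp only [iteratedDeriv_smul_apply, norm_mul, integral_const_mul, Finset.mul_sum])

theorem norms_apply (m : ℕ) (φ : SmoothL1) :
    norms m φ = ∑ i ∈ Finset.range (m + 1), ∫ x, ‖iteratedDeriv i φ x‖ := rfl

/-- The topology of `𝓓_{L¹}`, defined by the countable family of norms `|·|_{m,1}`. -/
noncomputable instance : TopologicalSpace SmoothL1 := norms.moduleFilterBasis.topology

theorem withSeminorms : WithSeminorms norms := ⟨rfl⟩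

/-- The inclusion of the test functions in `𝓓_{L¹}`. -/
noncomputable def ofTestFun (φ : TestFun) : SmoothL1 :=
  ⟨φ, φ.contDiff, fun i =>
    (φ.contDiff.continuous_iteratedDeriv i (mod_cast le_top)).integrable_of_hasCompactSupport
      (by
        induction i with
        | zero => simpa using φ.hasCompactSupport
        | succ i ih => rw [iteratedDeriv_succ]; exact ih.deriv)⟩

end SmoothL1

namespace CDistrib

/-- `T` belongs to `𝓓'_{L^∞}`, the topological dual of `𝓓_{L¹}`, viewed as a space of distributions
by restricting functionals to test functions. -/
def IsBounded (T : CDistrib) : Prop :=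
  ∃ L : SmoothL1 →L[ℂ] ℂ, ∀ φ : TestFun, T φ = L (SmoothL1.ofTestFun φ)

/-- Almost automorphic distributions: bounded distributions `T` such that `T * φ` is an almost
automorphic function for every test function `φ`. -/
def IsAlmostAutomorphic (T : CDistrib) : Prop :=
  T.IsBounded ∧ ∀ φ : TestFun, IsAlmostAutomorphicFun (T.conv φ)

/-- The vector distribution `U` solves the system `U' = A U + S`, in the sense of distributions. -/
def SolvesSystem {p : ℕ} (A : Matrix (Fin p) (Fin p) ℂ) (S U : Fin p → CDistrib) : Prop :=
  ∀ i, (U i).derivative = ∑ j, A i j • U j + S i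

end CDistrib

/-! Every norm of `SmoothL1` is translation invariant, so a bounded distribution, extended to a
functional `L`, has bounded orbits `s ↦ L (translate s φ)`. A Taylor estimate in L¹ shows that these
orbits are differentiable (`hasDerivAt_translate`), which reduces the scalar equation `U' = μ U + T`
to ordinary calculus. For T = 0, the function U * φ is a bounded multiple of `exp (μ x)` on the
whole line, hence zero when Re μ ≠ 0. In general a solution is an exponential average of translates
of T, taken in the direction in which the exponential decays (`expAverage_derivLM`). Convolving with
φ gives the same average of T * φ, and dominated convergence keeps it almost automorphic. For the
system, d/dt - A is the characteristic matrix of A evaluated at D = d/dt. Its adjugate reduces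
invertibility to that of χ_A(D), a product of the bijective factors D - μ
(`existsUnique_linear_system`). This runs once in the bounded distributions and once in the almost
automorphic ones; uniqueness in the larger space identifies the two solutions. -/

/-! ### Translation and differentiation on 𝓓_{L¹}. -/

namespace SmoothL1

theorem ext {φ ψ : SmoothL1} (h : ∀ x, φ x = ψ x) : φ = ψ := Subtype.ext (funext h)

/-- Translation on `𝓓_{L¹}`: `(τ_s φ)(y) = φ (y + s)`. -/
def translate (s : ℝ) : SmoothL1 →ₗ[ℂ] SmoothL1 where
  toFun φ := ⟨fun y => φ (y + s), φ.contDiff.comp (contDiff_id.add contDiff_const), fun i => by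
    rw [iteratedDeriv_comp_add_const]
    exact (φ.integrable i).comp_add_right s⟩
  map_add' _ _ := rfl
  map_smul' _ _ := rfl

theorem translate_apply (s : ℝ) (φ : SmoothL1) (y : ℝ) : translate s φ y = φ (y + s) := rfl

theorem translate_zero (φ : SmoothL1) : translate 0 φ = φ :=
  ext fun y => by rw [translate_apply, add_zero]

theorem translate_translate (s t : ℝ) (φ : SmoothL1) :
    translate s (translate t φ) = translate (s + t) φ :=
  ext fun y => by simp only [translate_apply, add_assoc]

theorem iteratedDeriv_translate (s : ℝ) (φ : SmoothL1) (i : ℕ) :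
    iteratedDeriv i (translate s φ) = fun y => iteratedDeriv i φ (y + s) := by
  change iteratedDeriv i (fun y => φ (y + s)) = _
  rw [iteratedDeriv_comp_add_const]

theorem norms_translate (m : ℕ) (s : ℝ) (φ : SmoothL1) : norms m (translate s φ) = norms m φ := by
  simp only [norms_apply, iteratedDeriv_translate]
  exact Finset.sum_congr rfl fun i _ =>
    integral_add_right_eq_self (fun y => ‖iteratedDeriv i φ y‖) s

theorem sup_norms_translate (t : Finset ℕ) (s : ℝ) (φ : SmoothL1) :
    t.sup norms (translate s φ) = t.sup norms φ := by
  induction t using Finset.cons_induction with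
  | empty => simp
  | cons a t ha ih => simp only [Finset.sup_cons, Seminorm.sup_apply, ih, norms_translate]

theorem contDiff_iteratedDeriv (φ : SmoothL1) (i : ℕ) : ContDiff ℝ ∞ (iteratedDeriv i φ) := by
  rw [iteratedDeriv_eq_iterate]
  exact φ.contDiff.iterate_deriv i

/-- The derivative on `𝓓_{L¹}`, as a linear map. -/
noncomputable def derivLM : SmoothL1 →ₗ[ℂ] SmoothL1 where
  toFun φ := ⟨iteratedDeriv 1 φ, contDiff_iteratedDeriv φ 1, fun i => by
    rw [iteratedDeriv_one, ← iteratedDeriv_succ']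
    exact φ.integrable (i + 1)⟩
  map_add' φ ψ := ext fun x => iteratedDeriv_add_apply φ ψ 1 x
  map_smul' c φ := ext fun x => iteratedDeriv_smul_apply c φ 1 x

theorem derivLM_coe (φ : SmoothL1) : (derivLM φ : ℝ → ℂ) = deriv φ := iteratedDeriv_one

theorem iteratedDeriv_derivLM (φ : SmoothL1) (i : ℕ) :
    iteratedDeriv i (derivLM φ) = iteratedDeriv (i + 1) φ := by
  rw [derivLM_coe, ← iteratedDeriv_succ']

theorem derivLM_translate (s : ℝ) (φ : SmoothL1) :
    derivLM (translate s φ) = translate s (derivLM φ) :=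
  ext fun y => congrFun (iteratedDeriv_translate s φ 1) y

theorem norms_derivLM_le (m : ℕ) (φ : SmoothL1) : norms m (derivLM φ) ≤ norms (m + 1) φ := by
  simp only [norms_apply, iteratedDeriv_derivLM]
  rw [Finset.sum_range_succ' _ (m + 1)]
  exact le_add_of_nonneg_right (integral_nonneg fun _ => norm_nonneg _)

/-- The derivative on `𝓓_{L¹}`, as a continuous linear map. -/
noncomputable def derivCLM : SmoothL1 →L[ℂ] SmoothL1 where
  toLinearMap := derivLM
  cont := withSeminorms.continuous_of_isBounded withSeminorms derivLM
    (.of_real fun m => ⟨{m + 1}, 1, fun φ => by simpa using norms_derivLM_le m φ⟩)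

theorem exists_bound (L : SmoothL1 →L[ℂ] ℂ) :
    ∃ (s : Finset ℕ) (C : ℝ), 0 ≤ C ∧ ∀ φ, ‖L φ‖ ≤ C * s.sup norms φ := by
  obtain ⟨s, C, -, h⟩ := Seminorm.bound_of_continuous withSeminorms
    ((normSeminorm ℂ ℂ).comp L.toLinearMap) (by exact continuous_norm.comp L.continuous)
  exact ⟨s, C, C.2, fun φ => h φ⟩

/-- Translations preserve each norm, so one bound serves all `r`. This is the only form in which
boundedness of a distribution enters the exponential averages and the uniqueness argument. -/
theorem exists_bound_translate (L : SmoothL1 →L[ℂ] ℂ) :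
    ∃ (s : Finset ℕ) (C : ℝ), 0 ≤ C ∧ ∀ (r : ℝ) (φ), ‖L (translate r φ)‖ ≤ C * s.sup norms φ := by
  obtain ⟨s, C, hC, h⟩ := exists_bound L
  exact ⟨s, C, hC, fun r φ => (h _).trans_eq (by rw [sup_norms_translate])⟩

/-- A linear functional on `𝓓_{L¹}` bounded by finitely many of the norms is continuous. -/
noncomputable def mkFunctional (L : SmoothL1 →ₗ[ℂ] ℂ) (s : Finset ℕ) (C : ℝ)
    (h : ∀ φ, ‖L φ‖ ≤ C * s.sup norms φ) : SmoothL1 →L[ℂ] ℂ where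
  toLinearMap := L
  cont := withSeminorms.continuous_of_isBounded (norm_withSeminorms ℂ ℂ) L
    (.of_real fun _ => ⟨s, C, fun φ => by simpa using h φ⟩)

end SmoothL1

/-! ### Taylor estimates in L¹. -/

section L1

/-- Minkowski's inequality for an interval of integration. -/
theorem lintegral_enorm_intervalIntegral_le {F : ℝ → ℝ → ℂ} (hF : Continuous fun p : ℝ × ℝ => F p.1 p.2)
    (h : ℝ) {C : ENNReal} (hC : ∀ θ, |θ| ≤ |h| → ∫⁻ x, ‖F x θ‖ₑ ≤ C) :
    ∫⁻ x, ‖∫ θ in (0 : ℝ)..h, F x θ‖ₑ ≤ C * ENNReal.ofReal |h| := by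
  calc ∫⁻ x, ‖∫ θ in (0 : ℝ)..h, F x θ‖ₑ
      ≤ ∫⁻ x, ∫⁻ θ in Set.uIoc 0 h, ‖F x θ‖ₑ := by
        refine lintegral_mono fun x => ?_
        rw [← ofReal_norm, intervalIntegral.norm_intervalIntegral_eq, ofReal_norm]
        exact enorm_integral_le_lintegral_enorm _
    _ = ∫⁻ θ in Set.uIoc 0 h, ∫⁻ x, ‖F x θ‖ₑ :=
        lintegral_lintegral_swap hF.enorm.measurable.aemeasurable
    _ ≤ ∫⁻ _ in Set.uIoc 0 h, C := by
        refine setLIntegral_mono measurable_const fun θ hθ => hC θ ?_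
        have := Set.abs_sub_left_of_mem_uIcc (Set.uIoc_subset_uIcc hθ)
        simpa using this
    _ = C * ENNReal.ofReal |h| := by
        rw [setLIntegral_const, Set.uIoc, Real.volume_Ioc]
        simp [max_sub_min_eq_abs']

theorem lintegral_enorm_sub_translate_le {g : ℝ → ℂ} (hg : ContDiff ℝ 1 g) (h : ℝ) :
    ∫⁻ x, ‖g (x + h) - g x‖ₑ ≤ (∫⁻ x, ‖deriv g x‖ₑ) * ENNReal.ofReal |h| := by
  have hc : Continuous (deriv g) := hg.continuous_deriv le_rfl
  have e : ∀ x, g (x + h) - g x = ∫ θ in (0 : ℝ)..h, deriv g (x + θ) := fun x => by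
    rw [intervalIntegral.integral_comp_add_left (deriv g) x, add_zero,
      intervalIntegral.integral_deriv_eq_sub
        (fun y _ => (hg.differentiable one_ne_zero).differentiableAt) (hc.intervalIntegrable _ _)]
  simp only [e]
  refine lintegral_enorm_intervalIntegral_le (F := fun x θ => deriv g (x + θ)) (by fun_prop) h
    fun θ _ => ?_
  exact (lintegral_add_right_eq_self (fun x => ‖deriv g x‖ₑ) θ).le

/-- The remainder is the integral over θ of `deriv g (x + θ) - deriv g x`, to which the first-order
estimate applies. Bounding |θ| by |h| loses the usual factor 1/2, which is harmless here. -/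
theorem lintegral_enorm_taylor_le {g : ℝ → ℂ} (hg : ContDiff ℝ 2 g) (h : ℝ) :
    ∫⁻ x, ‖g (x + h) - g x - h * deriv g x‖ₑ ≤
      (∫⁻ x, ‖deriv (deriv g) x‖ₑ) * ENNReal.ofReal |h| * ENNReal.ofReal |h| := by
  have hg1 : ContDiff ℝ 1 (deriv g) := by
    have : ContDiff ℝ (1 + 1) g := by convert hg using 1; norm_num
    exact (contDiff_succ_iff_deriv.1 this).2.2
  have hc : Continuous (deriv g) := hg1.continuous
  have e : ∀ x, g (x + h) - g x - h * deriv g x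
      = ∫ θ in (0 : ℝ)..h, (deriv g (x + θ) - deriv g x) := fun x => by
    rw [intervalIntegral.integral_sub (by apply Continuous.intervalIntegrable; fun_prop) (by simp),
      intervalIntegral.integral_comp_add_left (deriv g) x, add_zero,
      intervalIntegral.integral_deriv_eq_sub
        (fun y _ => (hg.differentiable two_ne_zero).differentiableAt) (hc.intervalIntegrable _ _)]
    simp
  simp only [e]
  refine lintegral_enorm_intervalIntegral_le (F := fun x θ => deriv g (x + θ) - deriv g x)
    (by fun_prop) h fun θ hθ => (lintegral_enorm_sub_translate_le hg1 θ).trans ?_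
  gcongr

theorem integral_norm_taylor_le {g : ℝ → ℂ} (hg : ContDiff ℝ 2 g)
    (hi : Integrable (deriv (deriv g))) (h : ℝ) :
    ∫ x, ‖g (x + h) - g x - h * deriv g x‖ ≤ (∫ x, ‖deriv (deriv g) x‖) * |h| * |h| := by
  have hc : Continuous (deriv g) := hg.continuous_deriv one_le_two
  have hc' := hg.continuous
  rw [integral_norm_eq_lintegral_enorm (by apply Continuous.aestronglyMeasurable; fun_prop),
    integral_norm_eq_lintegral_enorm hi.1]
  have := ENNReal.toReal_mono ?_ (lintegral_enorm_taylor_le hg h)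
  · simpa [ENNReal.toReal_mul] using this
  · exact ENNReal.mul_ne_top (ENNReal.mul_ne_top hi.2.ne ENNReal.ofReal_ne_top)
      ENNReal.ofReal_ne_top

end L1

/-! ### Differentiability of translation orbits. -/

namespace SmoothL1

theorem norms_taylor_le (m : ℕ) (φ : SmoothL1) (h : ℝ) :
    norms m (translate h φ - φ - (h : ℂ) • derivLM φ) ≤
      norms m (derivLM (derivLM φ)) * |h| * |h| := by
  simp only [norms_apply, Finset.sum_mul]
  refine Finset.sum_le_sum fun i _ => ?_
  have e : iteratedDeriv i (translate h φ - φ - (h : ℂ) • derivLM φ : SmoothL1) = fun x =>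
      iteratedDeriv i φ (x + h) - iteratedDeriv i φ x - h * deriv (iteratedDeriv i φ) x := by
    ext x
    have : translate h φ - φ - (h : ℂ) • derivLM φ =
        translate h φ + ((-1 : ℂ) • φ + (-h : ℂ) • derivLM φ) := by module
    rw [this, iteratedDeriv_add_apply, iteratedDeriv_add_apply, iteratedDeriv_smul_apply,
      iteratedDeriv_smul_apply, iteratedDeriv_translate, iteratedDeriv_derivLM, iteratedDeriv_succ]
    ring
  have e2 : iteratedDeriv i (derivLM (derivLM φ)) = deriv (deriv (iteratedDeriv i φ)) := by
    rw [iteratedDeriv_derivLM, iteratedDeriv_derivLM, iteratedDeriv_succ, iteratedDeriv_succ]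
  have hi := (derivLM (derivLM φ)).integrable i
  rw [e2] at hi ⊢
  rw [e]
  exact integral_norm_taylor_le (contDiff_infty.1 (contDiff_iteratedDeriv φ i) 2) hi h

theorem hasDerivAt_translate (L : SmoothL1 →L[ℂ] ℂ) (φ : SmoothL1) (r : ℝ) :
    HasDerivAt (fun s => L (translate s φ)) (L (translate r (derivLM φ))) r := by
  -- Translations form a group: the orbit of φ near `r` is the orbit of `translate r φ` near 0.
  wlog hr : r = 0 generalizing r φ
  · have := this (translate r φ) 0 rfl
    rw [translate_zero, derivLM_translate] at this
    have h2 := HasDerivAt.comp_sub_const (f := fun s => L (translate s (translate r φ))) r r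
      (by simpa using this)
    simpa [translate_translate] using h2
  subst hr
  obtain ⟨s, C, hC, hL⟩ := exists_bound L
  have hb : ∃ B : ℝ, ∀ h : ℝ, s.sup norms (translate h φ - φ - (h : ℂ) • derivLM φ) ≤ B * |h| * |h| := by
    refine ⟨s.sup norms (derivLM (derivLM φ)), fun h => ?_⟩
    refine Seminorm.finset_sup_apply_le (by positivity) fun m hm => (norms_taylor_le m φ h).trans ?_
    gcongr
    exact Finset.le_sup (f := norms) hm (derivLM (derivLM φ))
  obtain ⟨B, hB⟩ := hb
  rw [hasDerivAt_iff_isLittleO_nhds_zero]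
  have hO : (fun h : ℝ => L (translate (0 + h) φ) - L (translate 0 φ)
      - h • L (translate 0 (derivLM φ))) =O[𝓝 0] fun h : ℝ => h ^ 2 := by
    refine Asymptotics.IsBigO.of_bound (C * B) (Eventually.of_forall fun h => ?_)
    have : L (translate (0 + h) φ) - L (translate 0 φ) - h • L (translate 0 (derivLM φ))
        = L (translate h φ - φ - (h : ℂ) • derivLM φ) := by
      simp [translate_zero]
    rw [this]
    calc _ ≤ C * (B * |h| * |h|) := (hL _).trans (by gcongr; exact hB h)
      _ = _ := by rw [norm_pow, Real.norm_eq_abs]; ring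
  exact hO.trans_isLittleO (by simpa using Asymptotics.isLittleO_pow_id one_lt_two)

theorem continuous_translate (L : SmoothL1 →L[ℂ] ℂ) (φ : SmoothL1) :
    Continuous fun s => L (translate s φ) :=
  continuous_iff_continuousAt.2 fun r => (hasDerivAt_translate L φ r).continuousAt

end SmoothL1

/-! ### Passage between functionals on 𝓓_{L¹} and distributions. -/

namespace SmoothL1

/-- Each of the `m + 1` integrals lives on `K` and is at most the measure of `K` times a supremum.
This gives continuity of the inclusion on each 𝓓_K, which suffices for the inductive limit topology.
-/
theorem norms_ofTestFun_le {K : Compacts ℝ} (m : ℕ) (f : ContDiffMapSupportedIn ℝ ℂ (⊤ : ℕ∞) K) :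
    norms m (ofTestFun (TestFunction.ofSupportedIn (Ω := ⊤) (by simp) f)) ≤
      ((m + 1) * volume.real (K : Set ℝ)) *
        (Finset.range (m + 1)).sup (ContDiffMapSupportedIn.seminorm ℂ ℝ ℂ (⊤ : ℕ∞) K) f := by
  rw [norms_apply]
  have hK : volume (K : Set ℝ) < ⊤ := K.isCompact.measure_lt_top
  calc ∑ i ∈ Finset.range (m + 1),
        ∫ x, ‖iteratedDeriv i (ofTestFun (TestFunction.ofSupportedIn (Ω := ⊤) (by simp) f)) x‖
      ≤ ∑ i ∈ Finset.range (m + 1), volume.real (K : Set ℝ) *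
        (Finset.range (m + 1)).sup (ContDiffMapSupportedIn.seminorm ℂ ℝ ℂ (⊤ : ℕ∞) K) f := by
        refine Finset.sum_le_sum fun i hi => ?_
        change ∫ x, ‖iteratedDeriv i f x‖ ≤ _
        simp only [← norm_iteratedFDeriv_eq_norm_iteratedDeriv]
        have h0 : ∀ x ∉ (K : Set ℝ), ‖iteratedFDeriv ℝ i f x‖ = 0 := fun x hx => by
          rw [f.iteratedFDeriv_zero_on_compl hx, Pi.zero_apply, norm_zero]
        rw [← setIntegral_eq_integral_of_forall_compl_eq_zero h0, mul_comm]
        refine (Real.le_norm_self _).trans ?_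
        refine norm_setIntegral_le_of_norm_le_const hK fun x _ => ?_
        rw [norm_norm]
        exact (ContDiffMapSupportedIn.norm_iteratedFDeriv_apply_le_seminorm_top ℂ).trans
          (Finset.le_sup (f := ContDiffMapSupportedIn.seminorm ℂ ℝ ℂ (⊤ : ℕ∞) K) hi f)
    _ = _ := by rw [Finset.sum_const, Finset.card_range, nsmul_eq_mul]; push_cast; ring

/-- The distribution defined by a continuous functional on `𝓓_{L¹}`. -/
noncomputable def toDistrib (L : SmoothL1 →L[ℂ] ℂ) : CDistrib :=
  TestFunction.mkCLM ℂ (fun φ => L (ofTestFun φ)) (fun φ ψ => L.map_add (ofTestFun φ) (ofTestFun ψ))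
    (fun c φ => L.map_smul c (ofTestFun φ)) fun K hK => by
      let J : ContDiffMapSupportedIn ℝ ℂ (⊤ : ℕ∞) K →ₗ[ℂ] SmoothL1 :=
        { toFun := fun f => ofTestFun (TestFunction.ofSupportedIn (Ω := ⊤) hK f)
          map_add' := fun _ _ => rfl
          map_smul' := fun _ _ => rfl }
      have hJ : Continuous J := (ContDiffMapSupportedIn.withSeminorms ℂ ℝ ℂ (⊤ : ℕ∞) K
        ).continuous_of_isBounded withSeminorms J (.of_real fun m =>
          ⟨Finset.range (m + 1), (m + 1) * volume.real (K : Set ℝ), norms_ofTestFun_le m⟩)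
      exact L.continuous.comp hJ

theorem toDistrib_apply (L : SmoothL1 →L[ℂ] ℂ) (φ : TestFun) : toDistrib L φ = L (ofTestFun φ) :=
  rfl

theorem toDistrib_isBounded (L : SmoothL1 →L[ℂ] ℂ) : (toDistrib L).IsBounded :=
  ⟨L, fun _ => rfl⟩

theorem translate_ofTestFun_reflect (φ : TestFun) (x r : ℝ) :
    translate r (ofTestFun (CDistrib.reflect φ x)) = ofTestFun (CDistrib.reflect φ (x - r)) :=
  ext fun y => congrArg φ (by ring)

theorem ofTestFun_lineDeriv (φ : TestFun) :
    ofTestFun (TestFunction.lineDerivCLM ℂ (1 : ℝ) φ) = derivLM (ofTestFun φ) :=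
  ext fun y => by
    rw [derivLM_coe]
    exact CDistrib.lineDeriv_one_apply φ y

end SmoothL1

/-! ### Bounded distributions and uniqueness for the scalar equation. -/

namespace CDistrib

theorem reflect_reflect_zero (φ : TestFun) : reflect (reflect φ 0) 0 = φ :=
  TestFunction.ext fun y => congrArg φ (by ring)

theorem reflect_lineDeriv (φ : TestFun) (x : ℝ) :
    reflect (TestFunction.lineDerivCLM ℂ (1 : ℝ) φ) x =
      -(TestFunction.lineDerivCLM ℂ (1 : ℝ) (reflect φ x) : TestFun) :=
  TestFunction.ext fun y => by
    rw [neg_apply, lineDeriv_one_apply]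
    change (TestFunction.lineDerivCLM ℂ (1 : ℝ) φ : TestFun) (x - y) = -deriv (fun z => φ (x - z)) y
    rw [lineDeriv_one_apply, deriv_comp_const_sub, neg_neg]

theorem conv_derivative (T : CDistrib) (φ : TestFun) :
    T.derivative.conv φ = T.conv (TestFunction.lineDerivCLM ℂ (1 : ℝ) φ) := by
  ext x
  rw [conv, conv, derivative_apply, reflect_lineDeriv, map_neg]

theorem IsBounded.derivative {T : CDistrib} (hT : T.IsBounded) : T.derivative.IsBounded := by
  obtain ⟨L, hL⟩ := hT
  refine ⟨-(L.comp SmoothL1.derivCLM), fun φ => ?_⟩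
  rw [derivative_apply, hL, SmoothL1.ofTestFun_lineDeriv]
  rfl

/-- Convolutions are translation orbits run backwards, so bounds and derivatives of orbits transfer
to them. -/
theorem conv_eq_translate {T : CDistrib} {L : SmoothL1 →L[ℂ] ℂ}
    (hL : ∀ φ, T φ = L (SmoothL1.ofTestFun φ)) (φ : TestFun) (x : ℝ) :
    T.conv φ x = L (SmoothL1.translate (-x) (SmoothL1.ofTestFun (reflect φ 0))) := by
  rw [SmoothL1.translate_ofTestFun_reflect, sub_neg_eq_add, zero_add, conv, hL]

theorem IsBounded.exists_norm_conv_le {T : CDistrib} (hT : T.IsBounded) (φ : TestFun) :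
    ∃ C, ∀ x, ‖T.conv φ x‖ ≤ C := by
  obtain ⟨L, hL⟩ := hT
  obtain ⟨s, C, -, h⟩ := SmoothL1.exists_bound_translate L
  exact ⟨_, fun x => by rw [conv_eq_translate hL φ]; exact h _ _⟩

/-- A bounded distribution `U` with `U' = μ U`, where `Re μ ≠ 0`, vanishes. -/
theorem IsBounded.eq_zero_of_derivative_eq_smul {U : CDistrib} (hU : U.IsBounded) {μ : ℂ}
    (hμ : μ.re ≠ 0) (h : U.derivative = μ • U) : U = 0 := by
  ext φ
  -- Convolving with the reflected φ makes the value at 0 equal to `U φ`.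
  have hD : ∀ x : ℝ, HasDerivAt (U.conv (reflect φ 0)) (μ * U.conv (reflect φ 0) x) x := by
    intro x
    obtain ⟨L, hL⟩ := hU
    have h1 := (SmoothL1.hasDerivAt_translate L
      (SmoothL1.ofTestFun (reflect (reflect φ 0) 0)) (-x)).scomp x (hasDerivAt_neg x)
    have e : μ * U.conv (reflect φ 0) x = (-1 : ℝ) • L (SmoothL1.translate (-x)
        (SmoothL1.derivLM (SmoothL1.ofTestFun (reflect (reflect φ 0) 0)))) := by
      rw [← SmoothL1.derivLM_translate, SmoothL1.translate_ofTestFun_reflect,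
        ← SmoothL1.ofTestFun_lineDeriv, ← hL]
      change (μ • U) _ = _
      rw [← h, derivative_apply]
      simp
    rw [e, funext (conv_eq_translate hL _)]
    exact h1
  have hconst : ∀ x : ℝ, Complex.exp (-(μ * x)) * U.conv (reflect φ 0) x = U φ := by
    have hd : ∀ x : ℝ, HasDerivAt
        (fun x : ℝ => Complex.exp (-(μ * x)) * U.conv (reflect φ 0) x) 0 x := fun x => by
      have he : HasDerivAt (fun x : ℝ => Complex.exp (-(μ * x)))
          (Complex.exp (-(μ * x)) * -(μ * 1)) x :=
        (((hasDerivAt_id (x : ℂ)).const_mul μ).neg.cexp).comp_ofReal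
      exact (he.mul (hD x)).congr_deriv (by ring)
    intro x
    rw [is_const_of_deriv_eq_zero (fun x => (hd x).differentiableAt) (fun x => (hd x).deriv) x 0]
    simp [conv, reflect_reflect_zero]
  obtain ⟨C, hC⟩ := hU.exists_norm_conv_le (reflect φ 0)
  -- Evaluating at `r / μ.re` covers both signs of Re μ: the exponential factor then has modulus
  -- `exp (-r)`.
  have hb : ∀ r : ℝ, ‖U φ‖ ≤ Real.exp (-r) * C := fun r => by
    have hr := hconst (r / μ.re)
    rw [← hr, norm_mul, Complex.norm_exp]
    have : (-(μ * ((r / μ.re : ℝ) : ℂ))).re = -r := by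
      rw [Complex.neg_re, Complex.re_mul_ofReal, mul_div_cancel₀ _ hμ]
    rw [this]
    gcongr
    exact hC _
  have ht : Tendsto (fun r => Real.exp (-r) * C) atTop (𝓝 (0 * C)) :=
    (Real.tendsto_exp_neg_atTop_nhds_zero).mul_const C
  rw [zero_mul] at ht
  simpa using le_antisymm (ge_of_tendsto' ht hb) (norm_nonneg _)

end CDistrib

/-! ### Exponential averages of translates. -/

namespace SmoothL1

theorem integrableOn_exp_mul_translate {a : ℂ} (ha : a.re < 0) (σ : ℝ) (L : SmoothL1 →L[ℂ] ℂ)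
    (φ : SmoothL1) :
    IntegrableOn (fun t : ℝ => Complex.exp (a * t) * L (translate (σ * t) φ)) (Set.Ioi 0) := by
  obtain ⟨s, C, -, h⟩ := exists_bound_translate L
  exact (integrableOn_exp_mul_complex_Ioi ha 0).mul_bdd (c := C * s.sup norms φ)
    ((continuous_translate L φ).comp (continuous_const_mul σ)).aestronglyMeasurable
    (Eventually.of_forall fun t => h _ φ)

/-- The functional `φ ↦ ∫_0^∞ e^{a t} L (τ_{σ t} φ) dt`. -/
noncomputable def expAverageLM {a : ℂ} (ha : a.re < 0) (σ : ℝ) (L : SmoothL1 →L[ℂ] ℂ) :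
    SmoothL1 →ₗ[ℂ] ℂ where
  toFun φ := ∫ t in Set.Ioi (0 : ℝ), Complex.exp (a * t) * L (translate (σ * t) φ)
  map_add' φ ψ := by
    simp only [map_add, mul_add]
    exact integral_add (integrableOn_exp_mul_translate ha σ L φ)
      (integrableOn_exp_mul_translate ha σ L ψ)
  map_smul' c φ := by
    simp only [map_smul, smul_eq_mul, RingHom.id_apply, mul_left_comm _ c]
    exact integral_const_mul _ _

theorem exists_bound_expAverageLM {a : ℂ} (ha : a.re < 0) (σ : ℝ) (L : SmoothL1 →L[ℂ] ℂ) :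
    ∃ (s : Finset ℕ) (C : ℝ), ∀ φ, ‖expAverageLM ha σ L φ‖ ≤ C * s.sup norms φ := by
  obtain ⟨s, C, hC, h⟩ := exists_bound_translate L
  refine ⟨s, (∫ t in Set.Ioi (0 : ℝ), ‖Complex.exp (a * t)‖) * C, fun φ => ?_⟩
  rw [mul_assoc, ← integral_mul_const]
  refine norm_integral_le_of_norm_le
    ((integrableOn_exp_mul_complex_Ioi ha 0).norm.mul_const _) (Eventually.of_forall fun t => ?_)
  rw [norm_mul]
  gcongr
  exact h _ φ

/-- The functional `φ ↦ ∫_0^∞ e^{a t} L (τ_{σ t} φ) dt`, as a continuous linear map. -/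
noncomputable def expAverage {a : ℂ} (ha : a.re < 0) (σ : ℝ) (L : SmoothL1 →L[ℂ] ℂ) :
    SmoothL1 →L[ℂ] ℂ :=
  mkFunctional (expAverageLM ha σ L) _ _ (exists_bound_expAverageLM ha σ L).choose_spec.choose_spec

theorem expAverage_apply {a : ℂ} (ha : a.re < 0) (σ : ℝ) (L : SmoothL1 →L[ℂ] ℂ) (φ : SmoothL1) :
    expAverage ha σ L φ =
      ∫ t in Set.Ioi (0 : ℝ), Complex.exp (a * t) * L (translate (σ * t) φ) := rfl

/-- The left side is the integral over (0, ∞) of the derivative of `exp (a t) * L (translate (σ t)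
φ)`, which is `L φ` at 0 and tends to 0 at infinity. -/
theorem expAverage_derivLM {a : ℂ} (ha : a.re < 0) (σ : ℝ) (L : SmoothL1 →L[ℂ] ℂ) (φ : SmoothL1) :
    a * expAverage ha σ L φ + σ * expAverage ha σ L (derivLM φ) = -L φ := by
  have hd : ∀ t : ℝ, HasDerivAt (fun t : ℝ => Complex.exp (a * t) * L (translate (σ * t) φ))
      (a * (Complex.exp (a * t) * L (translate (σ * t) φ)) +
        σ * (Complex.exp (a * t) * L (translate (σ * t) (derivLM φ)))) t := by
    intro t
    have h1 : HasDerivAt (fun t : ℝ => Complex.exp (a * t)) (Complex.exp (a * t) * (a * 1)) t :=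
      (((hasDerivAt_id (t : ℂ)).const_mul a).cexp).comp_ofReal
    have h2 : HasDerivAt (fun t : ℝ => L (translate (σ * t) φ))
        ((σ * 1) • L (translate (σ * t) (derivLM φ))) t :=
      (hasDerivAt_translate L φ (σ * t)).scomp t ((hasDerivAt_id t).const_mul σ)
    refine (h1.mul h2).congr_deriv ?_
    rw [Complex.real_smul]
    push_cast
    ring
  have hi := ((integrableOn_exp_mul_translate ha σ L φ).const_mul a).add
    ((integrableOn_exp_mul_translate ha σ L (derivLM φ)).const_mul (σ : ℂ))
  have ht : Tendsto (fun t : ℝ => Complex.exp (a * t) * L (translate (σ * t) φ)) atTop (𝓝 0) := by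
    obtain ⟨s, C, -, h⟩ := exists_bound_translate L
    have he : Tendsto (fun t : ℝ => Complex.exp (a * t)) atTop (𝓝 0) := by
      simpa [Complex.tendsto_exp_nhds_zero_iff] using
        tendsto_const_nhds.neg_mul_atTop ha tendsto_id
    exact he.zero_mul_isBoundedUnder_le
      (isBoundedUnder_of ⟨C * s.sup norms φ, fun t => h _ φ⟩)
  have := integral_Ioi_of_hasDerivAt_of_tendsto (a := 0) (hd 0).continuousAt.continuousWithinAt
    (fun t _ => hd t) hi ht
  rw [expAverage_apply, expAverage_apply, ← integral_const_mul, ← integral_const_mul,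
    ← integral_add ((integrableOn_exp_mul_translate ha σ L φ).const_mul a)
    ((integrableOn_exp_mul_translate ha σ L (derivLM φ)).const_mul (σ : ℂ)), this]
  simp [translate_zero]

end SmoothL1

/-! ### Almost automorphic functions. -/

section AlmostAutomorphic

theorem IsAlmostAutomorphicFun.add {f₁ f₂ : ℝ → ℂ} (h₁ : IsAlmostAutomorphicFun f₁)
    (h₂ : IsAlmostAutomorphicFun f₂) : IsAlmostAutomorphicFun (f₁ + f₂) := by
  refine ⟨h₁.1.add h₂.1, fun s => ?_⟩
  obtain ⟨k₁, hk₁, g₁, a₁, b₁⟩ := h₁.2 s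
  -- Extracting from the subsequence already found for `f₁` makes both functions converge along it.
  obtain ⟨k₂, hk₂, g₂, a₂, b₂⟩ := h₂.2 (s ∘ k₁)
  exact ⟨k₁ ∘ k₂, hk₁.comp hk₂, g₁ + g₂,
    fun x => ((a₁ x).comp hk₂.tendsto_atTop).add (a₂ x),
    fun x => ((b₁ x).comp hk₂.tendsto_atTop).add (b₂ x)⟩

theorem IsAlmostAutomorphicFun.const_smul {f : ℝ → ℂ} (h : IsAlmostAutomorphicFun f) (c : ℂ) :
    IsAlmostAutomorphicFun (c • f) := by
  refine ⟨h.1.const_smul c, fun s => ?_⟩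
  obtain ⟨k, hk, g, a, b⟩ := h.2 s
  exact ⟨k, hk, c • g, fun x => (a x).const_smul c, fun x => (b x).const_smul c⟩

theorem isAlmostAutomorphicFun_zero : IsAlmostAutomorphicFun 0 :=
  ⟨continuous_const, fun _ => ⟨id, strictMono_id, 0, fun _ => tendsto_const_nhds,
    fun _ => tendsto_const_nhds⟩⟩

/-- Exponential averages of bounded almost automorphic functions are almost automorphic. -/
theorem IsAlmostAutomorphicFun.expAverage {f : ℝ → ℂ} (h : IsAlmostAutomorphicFun f) {C : ℝ}
    (hC : ∀ x, ‖f x‖ ≤ C) {a : ℂ} (ha : a.re < 0) (σ : ℝ) :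
    IsAlmostAutomorphicFun
      fun x => ∫ t in Set.Ioi (0 : ℝ), Complex.exp (a * t) * f (x - σ * t) := by
  -- Dominated convergence for a general filter, used with `𝓝 x` for continuity and with `atTop` for
  -- both limits along the subsequence.
  have key : ∀ {ι : Type} {l : Filter ι} [l.IsCountablyGenerated] (F : ι → ℝ → ℂ) (G : ℝ → ℂ),
      (∀ n, Measurable (F n)) → (∀ n x, ‖F n x‖ ≤ C) → (∀ x, Tendsto (F · x) l (𝓝 (G x))) →
      Tendsto (fun n => ∫ t in Set.Ioi (0 : ℝ), Complex.exp (a * t) * F n t) l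
        (𝓝 (∫ t in Set.Ioi (0 : ℝ), Complex.exp (a * t) * G t)) := by
    intro ι l _ F G hm hb ht
    refine tendsto_integral_filter_of_dominated_convergence (fun t => ‖Complex.exp (a * t)‖ * C)
      (Eventually.of_forall fun n => ?_)
      (Eventually.of_forall fun n => Eventually.of_forall fun t => ?_)
      ((integrableOn_exp_mul_complex_Ioi ha 0).norm.mul_const C)
      (Eventually.of_forall fun t => (ht t).const_mul _)
    · have : Measurable fun t : ℝ => Complex.exp (a * t) := by fun_prop
      exact (this.mul (hm n)).aestronglyMeasurable
    · rw [norm_mul]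
      gcongr
      exact hb n t
  have hc := h.1
  refine ⟨continuous_iff_continuousAt.2 fun x => ?_, fun s => ?_⟩
  · refine key (fun y t => f (y - σ * t)) _ (fun y => ?_) (fun _ _ => hC _) fun t => ?_
    · exact (by fun_prop : Continuous fun t => f (y - σ * t)).measurable
    · exact (by fun_prop : Continuous fun y => f (y - σ * t)).continuousAt
  · obtain ⟨k, hk, g, hg, hf⟩ := h.2 s
    -- The limit `g` need not be continuous; as a pointwise limit it is measurable and inherits the
    -- bound `C`, which is enough for the return limit.
    have hgm : Measurable g := measurable_of_tendsto_metrizable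
      (fun n => (by fun_prop : Continuous fun x => f (x + s (k n))).measurable)
      (tendsto_pi_nhds.2 hg)
    have hgC : ∀ x, ‖g x‖ ≤ C := fun x =>
      le_of_tendsto (hg x).norm (Eventually.of_forall fun _ => hC _)
    refine ⟨k, hk, fun x => ∫ t in Set.Ioi (0 : ℝ), Complex.exp (a * t) * g (x - σ * t),
      fun x => ?_, fun x => ?_⟩
    · refine key (fun n t => f (x + s (k n) - σ * t)) _ (fun n => ?_) (fun _ _ => hC _) fun t => ?_
      · exact (by fun_prop : Continuous fun t => f (x + s (k n) - σ * t)).measurable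
      · simpa only [sub_add_eq_add_sub] using hg (x - σ * t)
    · refine key (fun n t => g (x - s (k n) - σ * t)) _ (fun n => ?_) (fun _ _ => hgC _) fun t => ?_
      · exact hgm.comp (by fun_prop)
      · simpa only [sub_right_comm] using hf (x - σ * t)

end AlmostAutomorphic

/-! ### Existence for the scalar equation. -/

namespace CDistrib

theorem conv_toDistrib_expAverage {T : CDistrib} {L : SmoothL1 →L[ℂ] ℂ}
    (hL : ∀ φ, T φ = L (SmoothL1.ofTestFun φ)) {a : ℂ} (ha : a.re < 0) (σ : ℝ) (φ : TestFun) :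
    (SmoothL1.toDistrib (SmoothL1.expAverage ha σ L)).conv φ =
      fun x => ∫ t in Set.Ioi (0 : ℝ), Complex.exp (a * t) * T.conv φ (x - σ * t) := by
  ext x
  rw [conv, SmoothL1.toDistrib_apply, SmoothL1.expAverage_apply]
  simp only [SmoothL1.translate_ofTestFun_reflect, ← hL]
  rfl

/-- For `Re μ ≠ 0`, the equation `U' = μ U + T` with `T` bounded has a bounded solution `U`, which
is almost automorphic if `T` is. -/
theorem IsBounded.exists_derivative_sub_smul_eq {T : CDistrib} (hT : T.IsBounded) {μ : ℂ}
    (hμ : μ.re ≠ 0) : ∃ U : CDistrib, U.IsBounded ∧ U.derivative - μ • U = T ∧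
      (T.IsAlmostAutomorphic → U.IsAlmostAutomorphic) := by
  -- The sign σ selects the half-line over which to average; the rate is `a = σ μ`.
  have hσ : ∃ σ : ℝ, ((σ : ℂ) * μ).re < 0 := by
    rcases hμ.lt_or_gt with h | h
    · exact ⟨1, by simpa using h⟩
    · exact ⟨-1, by simpa using h⟩
  obtain ⟨σ, ha⟩ := hσ
  have hTb := hT
  obtain ⟨L, hL⟩ := hT
  refine ⟨SmoothL1.toDistrib ((σ : ℂ) • SmoothL1.expAverage ha σ L),
    SmoothL1.toDistrib_isBounded _, ?_, fun hAA => ⟨SmoothL1.toDistrib_isBounded _, fun φ => ?_⟩⟩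
  · ext φ
    have h := SmoothL1.expAverage_derivLM ha σ L (SmoothL1.ofTestFun φ)
    change -((σ : ℂ) * SmoothL1.expAverage ha σ L 
      (SmoothL1.ofTestFun (TestFunction.lineDerivCLM ℂ (1 : ℝ) φ)))
      - μ * ((σ : ℂ) * SmoothL1.expAverage ha σ L (SmoothL1.ofTestFun φ)) = T φ
    rw [SmoothL1.ofTestFun_lineDeriv, hL]
    linear_combination -h
  · change IsAlmostAutomorphicFun
      ((σ : ℂ) • (SmoothL1.toDistrib (SmoothL1.expAverage ha σ L)).conv φ)
    rw [conv_toDistrib_expAverage hL]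
    obtain ⟨C, hC⟩ := hTb.exists_norm_conv_le φ
    exact ((hAA.2 φ).expAverage hC ha σ).const_smul _

end CDistrib

/-! ### Linear systems over a vector space with an endomorphism. -/

section Algebra

open Polynomial in
theorem Module.End.isUnit_aeval_of_splits {K V : Type*} [Field K] [AddCommGroup V] [Module K V]
    (D : Module.End K V) {q : K[X]} (hq : q.Splits) (hm : q.Monic)
    (h : ∀ μ ∈ q.roots, Function.Bijective fun v => D v - μ • v) : IsUnit (aeval D q) := by
  rw [hq.eq_prod_roots_of_monic hm]
  generalize q.roots = s at h
  induction s using Multiset.induction_on with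
  | empty => simp
  | cons μ s ih =>
    rw [Multiset.map_cons, Multiset.prod_cons, map_mul]
    refine IsUnit.mul ?_ (ih fun ν hν => h ν (Multiset.mem_cons_of_mem hν))
    rw [map_sub, aeval_X, aeval_C]
    exact (Module.End.isUnit_iff _).2 (h μ (Multiset.mem_cons_self _ _))

open Polynomial in
/-- A matrix of polynomials in `D` acting on vectors with entries in `V`. -/
noncomputable def polyMatrixAction {K V n : Type*} [Field K] [AddCommGroup V] [Module K V] [Fintype n]
    (D : Module.End K V) (B : Matrix n n K[X]) (v : n → V) : n → V :=
  fun i => ∑ j, aeval D (B i j) (v j)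

section

open Polynomial

variable {K V n : Type*} [Field K] [AddCommGroup V] [Module K V] [Fintype n]

/-- Evaluation at `D` is a ring homomorphism, so identities between polynomial matrices, such as
those for the adjugate, become identities between operators. -/
theorem polyMatrixAction_mul (D : Module.End K V) (B C : Matrix n n K[X]) (v : n → V) :
    polyMatrixAction D (B * C) v = polyMatrixAction D B (polyMatrixAction D C v) := by
  ext i
  simp only [polyMatrixAction, Matrix.mul_apply, map_sum, map_mul, LinearMap.sum_apply,
    Module.End.mul_apply]
  exact Finset.sum_comm

variable [DecidableEq n]

theorem polyMatrixAction_smul_one (D : Module.End K V) (c : K[X]) (v : n → V) (i : n) :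
    polyMatrixAction D (c • (1 : Matrix n n K[X])) v i = aeval D c (v i) := by
  simp only [polyMatrixAction, Matrix.smul_apply, Matrix.one_apply, smul_eq_mul, mul_ite, mul_one,
    mul_zero]
  rw [Finset.sum_eq_single i (fun j _ hj => by simp [hj.symm]) (by simp)]
  simp

theorem polyMatrixAction_charmatrix (D : Module.End K V) (A : Matrix n n K) (v : n → V) (i : n) :
    polyMatrixAction D A.charmatrix v i = D (v i) - ∑ j, A i j • v j := by
  simp only [polyMatrixAction, Matrix.charmatrix_apply, map_sub, aeval_C, LinearMap.sub_apply,
    Finset.sum_sub_distrib, Module.algebraMap_end_apply]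
  rw [Finset.sum_eq_single i (fun j _ hj => by simp [Matrix.diagonal_apply_ne _ hj.symm]) (by simp)]
  simp

/-- If `D - μ` is bijective for each root `μ` of the characteristic polynomial of `A`, then
the system `D u = A u + s` is uniquely solvable. -/
theorem existsUnique_linear_system (D : Module.End K V) (A : Matrix n n K)
    (hs : A.charpoly.Splits)
    (h : ∀ μ ∈ A.charpoly.roots, Function.Bijective fun v => D v - μ • v) (s : n → V) :
    ∃! u : n → V, ∀ i, D (u i) = ∑ j, A i j • u j + s i := by
  have hbij := (Module.End.isUnit_iff _).1
    (Module.End.isUnit_aeval_of_splits D hs A.charpoly_monic h)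
  have key : ∀ u : n → V, (∀ i, D (u i) = ∑ j, A i j • u j + s i) ↔
      polyMatrixAction D A.charmatrix u = s := fun u => by
    simp only [funext_iff, polyMatrixAction_charmatrix, sub_eq_iff_eq_add, add_comm]
  simp only [key]
  -- Solving χ_A(D) w = s entrywise, the adjugate applied to `w` solves the system.
  choose w hw using fun i => hbij.2 (s i)
  refine ⟨polyMatrixAction D A.charmatrix.adjugate w, ?_, fun u hu => ?_⟩
  · change polyMatrixAction D A.charmatrix (polyMatrixAction D A.charmatrix.adjugate w) = s
    rw [← polyMatrixAction_mul, Matrix.mul_adjugate]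
    ext i
    rw [polyMatrixAction_smul_one]
    exact hw i
  · have e : ∀ v : n → V, (∀ i, polyMatrixAction D A.charmatrix.adjugate
        (polyMatrixAction D A.charmatrix v) i = aeval D A.charpoly (v i)) := fun v i => by
      rw [← polyMatrixAction_mul, Matrix.adjugate_mul, polyMatrixAction_smul_one]
      rfl
    have e2 : polyMatrixAction D A.charmatrix (polyMatrixAction D A.charmatrix.adjugate w) = s := by
      rw [← polyMatrixAction_mul, Matrix.mul_adjugate]
      ext i
      rw [polyMatrixAction_smul_one]
      exact hw i
    ext i
    apply hbij.1
    rw [← e, ← e, hu, e2]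

/-- The restriction to `N` is essential for distributions: on the whole space D - μ kills `exp (μ
x)`, and only boundedness makes it injective. -/
theorem existsUnique_linear_system_of_mem (D : V →ₗ[K] V) (N : Submodule K V)
    (hD : ∀ v ∈ N, D v ∈ N) (A : Matrix n n K) (hs : A.charpoly.Splits)
    (hinj : ∀ μ ∈ A.charpoly.roots, ∀ v ∈ N, D v = μ • v → v = 0)
    (hsurj : ∀ μ ∈ A.charpoly.roots, ∀ w ∈ N, ∃ v ∈ N, D v - μ • v = w)
    (s : n → V) (hsN : ∀ i, s i ∈ N) :
    ∃! u : n → V, (∀ i, u i ∈ N) ∧ ∀ i, D (u i) = ∑ j, A i j • u j + s i := by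
  have hbij : ∀ μ ∈ A.charpoly.roots,
      Function.Bijective fun v : N => D.restrict hD v - μ • v := by
    refine fun μ hμ => ⟨fun u v huv => ?_, fun w => ?_⟩
    · have h : D u - μ • (u : V) = D v - μ • (v : V) := congrArg Subtype.val huv
      refine Subtype.ext (sub_eq_zero.1 (hinj μ hμ _ (N.sub_mem u.2 v.2) ?_))
      rw [map_sub, smul_sub]
      exact sub_eq_sub_iff_sub_eq_sub.1 h
    · obtain ⟨v, hv, h⟩ := hsurj μ hμ w w.2
      exact ⟨⟨v, hv⟩, Subtype.ext h⟩
  obtain ⟨u, hu, huniq⟩ := existsUnique_linear_system (D.restrict hD) A hs hbij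
    fun i => ⟨s i, hsN i⟩
  have key : ∀ v : n → N, (∀ i, D.restrict hD (v i) = ∑ j, A i j • v j + ⟨s i, hsN i⟩) ↔
      ∀ i, D (v i) = ∑ j, A i j • (v j : V) + s i := fun v =>
    forall_congr' fun i => by
      rw [Subtype.ext_iff, Submodule.coe_add, Submodule.coe_sum]
      rfl
  refine ⟨fun i => u i, ⟨fun i => (u i).2, (key u).1 hu⟩, fun w ⟨hw, hsol⟩ => ?_⟩
  have := huniq (fun i => ⟨w i, hw i⟩) ((key _).2 hsol)
  rw [← this]

end

end Algebra

/-! ### The system in spaces of bounded distributions. -/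

namespace CDistrib

/-- The derivative of distributions, as a linear map. -/
noncomputable def derivativeLM : CDistrib →ₗ[ℂ] CDistrib where
  toFun := derivative
  map_add' T U := by ext φ; exact neg_add _ _
  map_smul' c T := by ext φ; exact (mul_neg c _).symm

/-- The space `𝓓'_{L^∞}` of bounded distributions. -/
def boundedSubmodule : Submodule ℂ CDistrib where
  carrier := {T | T.IsBounded}
  zero_mem' := ⟨0, fun _ => rfl⟩
  add_mem' := by
    rintro T U ⟨L, hL⟩ ⟨M, hM⟩
    exact ⟨L + M, fun φ => congrArg₂ (· + ·) (hL φ) (hM φ)⟩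
  smul_mem' := by
    rintro c T ⟨L, hL⟩
    exact ⟨c • L, fun φ => congrArg (c * ·) (hL φ)⟩

/-- The space of almost automorphic distributions. -/
def almostAutomorphicSubmodule : Submodule ℂ CDistrib where
  carrier := {T | T.IsAlmostAutomorphic}
  zero_mem' := ⟨boundedSubmodule.zero_mem, fun _ => isAlmostAutomorphicFun_zero⟩
  add_mem' hT hU := ⟨boundedSubmodule.add_mem hT.1 hU.1, fun φ => (hT.2 φ).add (hU.2 φ)⟩
  smul_mem' c _ hT := ⟨boundedSubmodule.smul_mem c hT.1, fun φ => (hT.2 φ).const_smul c⟩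

theorem IsAlmostAutomorphic.derivative {T : CDistrib} (hT : T.IsAlmostAutomorphic) :
    T.derivative.IsAlmostAutomorphic :=
  ⟨hT.1.derivative, fun φ => by rw [conv_derivative]; exact hT.2 _⟩

/-- If `N` is a space of bounded distributions, stable under differentiation and under the bounded
solution operators of `U' - μ U = T` for `Re μ ≠ 0`, then `U' = A U + S` is uniquely solvable
in `N`. -/
theorem existsUnique_solvesSystem {p : ℕ} (A : Matrix (Fin p) (Fin p) ℂ)
    (hA : ∀ μ : ℂ, Module.End.HasEigenvalue (Matrix.toLin' A) μ → μ.re ≠ 0)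
    (N : Submodule ℂ CDistrib) (hb : N ≤ boundedSubmodule) (hD : ∀ T ∈ N, T.derivative ∈ N)
    (hN : ∀ μ : ℂ, μ.re ≠ 0 → ∀ T ∈ N, ∃ U ∈ N, U.derivative - μ • U = T)
    (S : Fin p → CDistrib) (hS : ∀ i, S i ∈ N) :
    ∃! U : Fin p → CDistrib, (∀ i, U i ∈ N) ∧ SolvesSystem A S U := by
  have hre : ∀ μ ∈ A.charpoly.roots, μ.re ≠ 0 := fun μ hμ => hA μ <| by
    rw [Module.End.hasEigenvalue_iff_isRoot_charpoly, Matrix.charpoly_toLin']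
    exact Polynomial.isRoot_of_mem_roots hμ
  exact existsUnique_linear_system_of_mem derivativeLM N hD A (IsAlgClosed.splits _)
    (fun μ hμ U hU h => (hb hU).eq_zero_of_derivative_eq_smul (hre μ hμ) h)
    (fun μ hμ => hN μ (hre μ hμ)) S hS

end CDistrib

theorem mainTheorem3 {p : ℕ} (A : Matrix (Fin p) (Fin p) ℂ)
    (hA : ∀ μ : ℂ, Module.End.HasEigenvalue (Matrix.toLin' A) μ → μ.re ≠ 0)
    (S : Fin p → CDistrib) (hS : ∀ i, (S i).IsAlmostAutomorphic) :
    (∃! U : Fin p → CDistrib, (∀ i, (U i).IsBounded) ∧ CDistrib.SolvesSystem A S U) ∧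
    (∀ U : Fin p → CDistrib, (∀ i, (U i).IsBounded) → CDistrib.SolvesSystem A S U →
      ∀ i, (U i).IsAlmostAutomorphic) := by
  have hbdd := CDistrib.existsUnique_solvesSystem A hA CDistrib.boundedSubmodule le_rfl
    (fun _ => CDistrib.IsBounded.derivative)
    (fun μ hμ T hT => by
      obtain ⟨U, hU, h, -⟩ := CDistrib.IsBounded.exists_derivative_sub_smul_eq hT hμ
      exact ⟨U, hU, h⟩) S fun i => (hS i).1
  obtain ⟨V, ⟨hV, hVsol⟩, -⟩ := CDistrib.existsUnique_solvesSystem A hA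
    CDistrib.almostAutomorphicSubmodule (fun _ hT => hT.1)
    (fun _ => CDistrib.IsAlmostAutomorphic.derivative)
    (fun μ hμ T hT => by
      obtain ⟨U, -, h, hAA⟩ := CDistrib.IsBounded.exists_derivative_sub_smul_eq hT.1 hμ
      exact ⟨U, hAA hT, h⟩) S hS
  refine ⟨hbdd, fun U hU hUsol i => ?_⟩
  -- The almost automorphic solution `V` is bounded, so it coincides with any bounded solution.
  rw [hbdd.unique ⟨hU, hUsol⟩ ⟨fun i => (hV i).1, hVsol⟩]
  exact hV i
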